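/- Let $F$ be an algebraically closed field of characteristic different from $2$ and $3$. The Kac Jordan superalgebra $K_{10}=(K_{10})_{\bar 0}\oplus (K_{10})_{\bar 1}$ is the $\mathbb Z_2$-graded $F$-algebra whose even part has basis $e,a,b,c_1,c_2,f$, whose odd part has basis $p_1,p_2,q_1,q_2$, and whose bilinear product is supercommutative ($xy=(-1)^{\bar x\bar y}yx$ for homogeneous $x,y$) and determined by $$e^2=e,\quad ea=a,\quad eb=b,\quad ec_i=c_i,\quad f^2=f,\quad a^2=4e,\quad b^2=-4e,\quad c_1c_2=2e,$$ $$ez=fz=\tfrac12 z\ \ (z\in\{p_1,p_2,q_1,q_2\}),\quad ap_i=p_i,\quad aq_i=-q_i,\quad bp_i=q_i,\quad bq_i=-p_i\quad(i=1,2),$$ $$c_1p_2=q_1,\quad c_1q_2=p_1,\quad c_2p_1=q_2,\quad c_2q_1=p_2,$$ $$p_1p_2=a+2(e-3f),\quad q_1q_2=a-2(e-3f),\quad p_1q_1=2c_1,\quad p_2q_2=-2c_2,\quad p_1q_2=b,\quad p_2q_1=-b,$$ all products of two basis vectors that do not follow from these by supercommutativity being $0$. A graded subalgebra is a linear subspace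 $B$ that is closed under the product and satisfies $B=(B\cap (K_{10})_{\bar 0})\oplus(B\cap (K_{10})_{\bar 1})$ (it need not contain the unit element $1=e+f$); it is maximal if $B\neq K_{10}$ and no graded subalgebra lies strictly between $B$ and $K_{10}$. An automorphism of $K_{10}$ is a bijective linear map that preserves the product and the grading. Theorem 4.1. For every maximal graded subalgebra $B$ of $K_{10}$ there is an automorphism $\varphi$ of $K_{10}$ such that $\varphi(B)$ is one of the following: (i) $(K_{10})_{\bar 0}$; (ii) the subalgebra with basis $\{e,f,a,p_1,p_2\}$; (iii) the subalgebra with basis $\{e,f,a+b,c_1,p_1,q_1,p_2+q_2\}$; (iv) the subalgebra with basis $\{e,f,a,b,c_1,p_1,q_1\}$. Conversely, each of (i)–(iv) is a maximal graded subalgebra of $K_{10}$. -/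

import Mathlib

/-- Labels of the ten basis vectors of the Kac Jordan superalgebra. -/
inductive KacIdx : Type
  | e | a | b | c1 | c2 | f | p1 | p2 | q1 | q2
  deriving DecidableEq

instance : Fintype KacIdx where
  elems := {.e, .a, .b, .c1, .c2, .f, .p1, .p2, .q1, .q2}
  complete i := by cases i <;> decide

/-- The degree of a basis vector: `p1, p2, q1, q2` are odd, the other six are even. -/
def KacIdx.parity : KacIdx → ZMod 2
  | .p1 | .p2 | .q1 | .q2 => 1
  | _ => 0

/-- The underlying vector space of the Kac superalgebra over `F`: coordinate vectors with respect
to the basis `e, a, b, c1, c2, f, p1, p2, q1, q2`. -/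
def K10 (F : Type*) : Type _ := KacIdx → F

namespace K10

section

variable {F : Type*} [Field F]

instance : AddCommGroup (K10 F) := inferInstanceAs (AddCommGroup (KacIdx → F))

instance : Module F (K10 F) := inferInstanceAs (Module F (KacIdx → F))

/-- The basis vector with label `i`. -/
def v (i : KacIdx) : K10 F := (Pi.single i 1 : KacIdx → F)

/-- The multiplication table: `table i j` is the product of the `i`-th and the `j`-th
basis vector (in this order); products that are not listed vanish. -/
def table (i j : KacIdx) : K10 F :=
  match i with
  | .e => match j with
    | .e => v .e
    | .a => v .a
    | .b => v .b
    | .c1 => v .c1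
    | .c2 => v .c2
    | .p1 => (1 / 2 : F) • v .p1
    | .p2 => (1 / 2 : F) • v .p2
    | .q1 => (1 / 2 : F) • v .q1
    | .q2 => (1 / 2 : F) • v .q2
    | _ => 0
  | .a => match j with
    | .e => v .a
    | .a => (4 : F) • v .e
    | .p1 => v .p1
    | .p2 => v .p2
    | .q1 => -v .q1
    | .q2 => -v .q2
    | _ => 0
  | .b => match j with
    | .e => v .b
    | .b => -((4 : F) • v .e)
    | .p1 => v .q1
    | .p2 => v .q2
    | .q1 => -v .p1
    | .q2 => -v .p2
    | _ => 0
  | .c1 => match j with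
    | .e => v .c1
    | .c2 => (2 : F) • v .e
    | .p2 => v .q1
    | .q2 => v .p1
    | _ => 0
  | .c2 => match j with
    | .e => v .c2
    | .c1 => (2 : F) • v .e
    | .p1 => v .q2
    | .q1 => v .p2
    | _ => 0
  | .f => match j with
    | .f => v .f
    | .p1 => (1 / 2 : F) • v .p1
    | .p2 => (1 / 2 : F) • v .p2
    | .q1 => (1 / 2 : F) • v .q1
    | .q2 => (1 / 2 : F) • v .q2
    | _ => 0
  | .p1 => match j with
    | .e => (1 / 2 : F) • v .p1
    | .a => v .p1
    | .b => v .q1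
    | .c2 => v .q2
    | .f => (1 / 2 : F) • v .p1
    | .p2 => v .a + (2 : F) • v .e - (6 : F) • v .f
    | .q1 => (2 : F) • v .c1
    | .q2 => v .b
    | _ => 0
  | .p2 => match j with
    | .e => (1 / 2 : F) • v .p2
    | .a => v .p2
    | .b => v .q2
    | .c1 => v .q1
    | .f => (1 / 2 : F) • v .p2
    | .p1 => -v .a - (2 : F) • v .e + (6 : F) • v .f
    | .q1 => -v .b
    | .q2 => -((2 : F) • v .c2)
    | _ => 0
  | .q1 => match j with
    | .e => (1 / 2 : F) • v .q1
    | .a => -v .q1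
    | .b => -v .p1
    | .c2 => v .p2
    | .f => (1 / 2 : F) • v .q1
    | .p1 => -((2 : F) • v .c1)
    | .p2 => v .b
    | .q2 => v .a - (2 : F) • v .e + (6 : F) • v .f
    | _ => 0
  | .q2 => match j with
    | .e => (1 / 2 : F) • v .q2
    | .a => -v .q2
    | .b => -v .p2
    | .c1 => v .p1
    | .f => (1 / 2 : F) • v .q2
    | .p1 => -v .b
    | .p2 => (2 : F) • v .c2
    | .q1 => -v .a + (2 : F) • v .e - (6 : F) • v .f
    | _ => 0

/-- The product of `K10 F`: the bilinear extension of the multiplication table. -/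
instance : Mul (K10 F) := ⟨fun x y => ∑ i, ∑ j, (x i * y j) • table i j⟩

theorem mul_def (x y : K10 F) : x * y = ∑ i, ∑ j, (x i * y j) • table i j := rfl

@[simp] theorem add_apply (x y : K10 F) (i : KacIdx) : (x + y) i = x i + y i := rfl

@[simp] theorem zero_apply (i : KacIdx) : (0 : K10 F) i = 0 := rfl

@[simp] theorem smul_apply (r : F) (x : K10 F) (i : KacIdx) : (r • x) i = r * x i := rfl

instance : NonUnitalNonAssocRing (K10 F) where
  left_distrib x y z := by
    simp only [mul_def, add_apply, mul_add, add_smul, Finset.sum_add_distrib]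
  right_distrib x y z := by
    simp only [mul_def, add_apply, add_mul, add_smul, Finset.sum_add_distrib]
  zero_mul x := by simp [mul_def]
  mul_zero x := by simp [mul_def]

instance : IsScalarTower F (K10 F) (K10 F) :=
  ⟨fun r x y => by simp [mul_def, Finset.smul_sum, smul_smul, mul_assoc]⟩

instance : SMulCommClass F (K10 F) (K10 F) :=
  ⟨fun r x y => by simp [mul_def, Finset.smul_sum, smul_smul, mul_left_comm]⟩

variable (F) in
/-- The homogeneous component of degree `d`: the vectors that involve only basis vectors of
degree `d`. Degree `0` is the even part and degree `1` the odd part. -/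
def component (d : ZMod 2) : Submodule F (K10 F) where
  carrier := {x | ∀ i : KacIdx, i.parity ≠ d → x i = 0}
  add_mem' := fun {x y} hx hy i hi => by simp [hx i hi, hy i hi]
  zero_mem' := fun i _ => rfl
  smul_mem' := fun r x hx i hi => by simp [hx i hi]

/-- A subalgebra `B` is graded if every element of `B` is the sum of an even and an odd
element of `B`. Subalgebras are not required to contain the unit element `e + f`. -/
def IsGraded (B : NonUnitalSubalgebra F (K10 F)) : Prop :=
  ∀ x ∈ B, ∃ y ∈ B, ∃ z ∈ B, y ∈ component F 0 ∧ z ∈ component F 1 ∧ x = y + z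

/-- A maximal subalgebra in the graded sense: a maximal element, with respect to inclusion, among
the proper graded subalgebras. -/
def IsMaximalSubalgebra (B : NonUnitalSubalgebra F (K10 F)) : Prop :=
  Maximal (fun C : NonUnitalSubalgebra F (K10 F) => IsGraded C ∧ C ≠ ⊤) B

/-- A multiplicative linear map is an automorphism of the graded algebra if it is bijective and
preserves the degree. -/
def IsGradedAutomorphism (φ : K10 F →ₙₐ[F] K10 F) : Prop :=
  Function.Bijective φ ∧ ∀ d : ZMod 2, ∀ x ∈ component F d, φ x ∈ component F d

/-- The family `s` is a basis of the subalgebra `B`: it is linearly independent and its linear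
span is `B`. -/
def IsBasisOf {n : ℕ} (s : Fin n → K10 F) (B : NonUnitalSubalgebra F (K10 F)) : Prop :=
  LinearIndependent F s ∧ Submodule.span F (Set.range s) = B.toSubmodule

/-- `B` is the even part. -/
def IsType1 (B : NonUnitalSubalgebra F (K10 F)) : Prop :=
  B.toSubmodule = component F 0

/-- `B` has basis `e, f, a, p1, p2`. -/
def IsType2 (B : NonUnitalSubalgebra F (K10 F)) : Prop :=
  IsBasisOf ![v .e, v .f, v .a, v .p1, v .p2] B

/-- `B` has basis `e, f, a + b, c1, p1, q1, p2 + q2`. -/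
def IsType3 (B : NonUnitalSubalgebra F (K10 F)) : Prop :=
  IsBasisOf ![v .e, v .f, v .a + v .b, v .c1, v .p1, v .q1, v .p2 + v .q2] B

/-- `B` has basis `e, f, a, b, c1, p1, q1`. -/
def IsType4 (B : NonUnitalSubalgebra F (K10 F)) : Prop :=
  IsBasisOf ![v .e, v .f, v .a, v .b, v .c1, v .p1, v .q1] B

end

end K10

namespace K10

section

variable {F : Type*} [Field F]

/-! The odd part is S⁺ ⊕ S⁻, where S⁺ = ⟨p1 + q1, p2 - q2⟩ and S⁻ = ⟨p1 - q1, p2 + q2⟩ are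
symplectic planes, and the span of a, b, c1, c2 is S⁺ ⊗ S⁻ up to rescaling of coordinates. SL₂ acts
by automorphisms on each plane (`slHom`, `slHom'`), and `swapHom` exchanges the planes.

A proper graded subalgebra B is controlled by its odd part B₁. The odd part of the algebra generates
everything (`eq_top_of_odd_mem`), so B₁ is proper; and the even elements of B preserve B₁, which
bounds B from above (the lemmas `le_evenSubalgebra`, `le_diagonalSubalgebra`, ...). If B₁ = 0, then
B is even. If B₁ meets S⁺ or S⁻ nontrivially, it may be assumed to contain p1 + q1; the triple
product (`odd_triple_mem`) then splits B₁ into its intersections with the two planes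
(`odd_snd_mem`), and their dimensions put B inside (iii) or (iv). Otherwise B₁ is the graph of an
injective map from a subspace of S⁺ to S⁻: a line leads to (iv), while on a plane the triple product
forces the map to be symplectic, which leads to (ii).

So every proper graded subalgebra is carried into a standard one (`isSubstandard_of_ne_top`), and
maximality turns the inclusion into an equality. Conversely, a graded subalgebra above a standard
one either obeys the same linear conditions on its odd elements, and the same upper bounds apply, or
it has enough odd elements to be everything. -/

/-! ### Coordinates adapted to the half-spin modules -/

theorem sum_kacIdx {M : Type*} [AddCommMonoid M] (g : KacIdx → M) :
    ∑ i, g i = g .e + (g .a + (g .b + (g .c1 + (g .c2 + (g .f + (g .p1 + (g .p2 +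
      (g .q1 + g .q2)))))))) := by
  have : (Finset.univ : Finset KacIdx) = {.e, .a, .b, .c1, .c2, .f, .p1, .p2, .q1, .q2} := rfl
  rw [this]
  repeat rw [Finset.sum_insert (by decide)]
  rw [Finset.sum_singleton]

@[ext] theorem ext {K : Type*} {x y : K10 K} (h : ∀ i, x i = y i) : x = y := funext h

@[simp] theorem neg_apply (x : K10 F) (i : KacIdx) : (-x) i = -x i := rfl

@[simp] theorem sub_apply (x y : K10 F) (i : KacIdx) : (x - y) i = x i - y i := rfl

theorem v_apply (i j : KacIdx) : (v i : K10 F) j = if j = i then 1 else 0 := by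
  simp [v, Pi.single_apply]

/-- The element with coordinates `e, f, r, s, t, w, x, y, z, u` with respect to the basis
`e, f, c1, a + b, a - b, c2, p1 + q1, p2 - q2, p1 - q1, p2 + q2`. The first two and the last two of
the four odd basis vectors span the two half-spin modules. -/
def mk (e f r s t w x y z u : F) : K10 F
  | .e => e
  | .f => f
  | .a => s + t
  | .b => s - t
  | .c1 => r
  | .c2 => w
  | .p1 => x + z
  | .q1 => x - z
  | .p2 => y + u
  | .q2 => u - y

/-- The odd element with coordinates `x, y, z, u` with respect to
`p1 + q1, p2 - q2, p1 - q1, p2 + q2`. -/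
abbrev odd (x y z u : F) : K10 F := mk 0 0 0 0 0 0 x y z u

/-- The even element with coordinates `e, f, r, s, t, w` with respect to
`e, f, c1, a + b, a - b, c2`. -/
abbrev even (e f r s t w : F) : K10 F := mk e f r s t w 0 0 0 0

theorem exists_eq_mk (h2 : (2 : F) ≠ 0) (k : K10 F) :
    ∃ e f r s t w x y z u : F, k = mk e f r s t w x y z u := by
  refine ⟨k .e, k .f, k .c1, (k .a + k .b) / 2, (k .a - k .b) / 2, k .c2, (k .p1 + k .q1) / 2,
    (k .p2 - k .q2) / 2, (k .p1 - k .q1) / 2, (k .p2 + k .q2) / 2, ?_⟩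
  ext i
  cases i <;> simp only [mk] <;> field_simp <;> ring

theorem mk_add_mk (e f r s t w x y z u e' f' r' s' t' w' x' y' z' u' : F) :
    mk e f r s t w x y z u + mk e' f' r' s' t' w' x' y' z' u' =
      mk (e + e') (f + f') (r + r') (s + s') (t + t') (w + w') (x + x') (y + y') (z + z')
        (u + u') := by
  ext i
  cases i <;> simp only [mk, add_apply] <;> ring

theorem mk_sub_mk (e f r s t w x y z u e' f' r' s' t' w' x' y' z' u' : F) :
    mk e f r s t w x y z u - mk e' f' r' s' t' w' x' y' z' u' =
      mk (e - e') (f - f') (r - r') (s - s') (t - t') (w - w') (x - x') (y - y') (z - z')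
        (u - u') := by
  ext i
  cases i <;> simp only [mk, sub_apply] <;> ring

theorem smul_mk (c e f r s t w x y z u : F) :
    c • mk e f r s t w x y z u =
      mk (c * e) (c * f) (c * r) (c * s) (c * t) (c * w) (c * x) (c * y) (c * z) (c * u) := by
  ext i
  cases i <;> simp only [mk, smul_apply] <;> ring

/-- The symplectic forms x y' - y x' and z u' - u z' enter only through their sum, in the
coordinates of e and f. The mixed terms are the four coordinates of S⁺ ⊗ S⁻, which in turn maps each
half-spin module to the other. -/
theorem mk_mul_mk (h2 : (2 : F) ≠ 0)
    (e f r s t w x y z u e' f' r' s' t' w' x' y' z' u' : F) :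
    mk e f r s t w x y z u * mk e' f' r' s' t' w' x' y' z' u' =
      mk (e * e' + 2 * (r * w' + w * r') + 8 * (s * t' + t * s')
          + 4 * (x * y' - y * x' + z * u' - u * z'))
        (f * f' - 12 * (x * y' - y * x' + z * u' - u * z'))
        (e * r' + r * e' - 4 * (x * z' - z * x'))
        (e * s' + s * e' + 2 * (x * u' - u * x'))
        (e * t' + t * e' - 2 * (y * z' - z * y'))
        (e * w' + w * e' - 4 * (y * u' - u * y'))
        ((e + f) / 2 * x' + (e' + f') / 2 * x + 2 * (s * z' + s' * z) + (r * u' + r' * u))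
        ((e + f) / 2 * y' + (e' + f') / 2 * y + 2 * (t * u' + t' * u) - (w * z' + w' * z))
        ((e + f) / 2 * z' + (e' + f') / 2 * z + 2 * (t * x' + t' * x) - (r * y' + r' * y))
        ((e + f) / 2 * u' + (e' + f') / 2 * u + 2 * (s * y' + s' * y) + (w * x' + w' * x)) := by
  ext i
  simp only [mul_def, sum_kacIdx, table, add_apply, smul_apply, smul_zero, smul_add, smul_sub,
    zero_apply, smul_neg, neg_apply, sub_apply, v_apply]
  cases i <;> simp [mk] <;> field_simp <;> ring

theorem even_mul_odd (h2 : (2 : F) ≠ 0) (e f r s t w x y z u : F) :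
    even e f r s t w * odd x y z u =
      odd ((e + f) / 2 * x + 2 * s * z + r * u) ((e + f) / 2 * y + 2 * t * u - w * z)
        ((e + f) / 2 * z + 2 * t * x - r * y) ((e + f) / 2 * u + 2 * s * y + w * x) := by
  rw [mk_mul_mk h2]
  congr 1 <;> ring

theorem odd_mul_odd (h2 : (2 : F) ≠ 0) (x y z u x' y' z' u' : F) :
    odd x y z u * odd x' y' z' u' =
      even (4 * (x * y' - y * x' + z * u' - u * z')) (-12 * (x * y' - y * x' + z * u' - u * z'))
        (-4 * (x * z' - z * x')) (2 * (x * u' - u * x')) (-2 * (y * z' - z * y'))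
        (-4 * (y * u' - u * y')) := by
  rw [mk_mul_mk h2]
  congr 1 <;> ring

theorem mk_eq_even_add_odd (e f r s t w x y z u : F) :
    mk e f r s t w x y z u = even e f r s t w + odd x y z u := by
  simp [mk_add_mk]

theorem even_mem_component (e f r s t w : F) : even e f r s t w ∈ component F 0 := by
  intro i hi
  cases i <;> simp_all [KacIdx.parity, mk]

theorem odd_mem_component (x y z u : F) : odd x y z u ∈ component F 1 := by
  intro i hi
  cases i <;> simp_all [KacIdx.parity, mk]

theorem exists_eq_even (h2 : (2 : F) ≠ 0) {k : K10 F} (hk : k ∈ component F 0) :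
    ∃ e f r s t w : F, k = even e f r s t w := by
  refine ⟨k .e, k .f, k .c1, (k .a + k .b) / 2, (k .a - k .b) / 2, k .c2, ?_⟩
  ext i
  have h : ∀ j : KacIdx, j.parity ≠ 0 → k j = 0 := hk
  cases i <;> simp only [mk]
  case p1 => simp [h .p1 (by decide)]
  case p2 => simp [h .p2 (by decide)]
  case q1 => simp [h .q1 (by decide)]
  case q2 => simp [h .q2 (by decide)]
  all_goals field_simp
  all_goals ring

theorem exists_eq_odd (h2 : (2 : F) ≠ 0) {k : K10 F} (hk : k ∈ component F 1) :
    ∃ x y z u : F, k = odd x y z u := by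
  refine ⟨(k .p1 + k .q1) / 2,
    (k .p2 - k .q2) / 2, (k .p1 - k .q1) / 2, (k .p2 + k .q2) / 2, ?_⟩
  ext i
  have h : ∀ j : KacIdx, j.parity ≠ 1 → k j = 0 := hk
  cases i <;> simp only [mk]
  case e => simp [h .e (by decide)]
  case a => simp [h .a (by decide)]
  case b => simp [h .b (by decide)]
  case c1 => simp [h .c1 (by decide)]
  case c2 => simp [h .c2 (by decide)]
  case f => simp [h .f (by decide)]
  all_goals field_simp
  all_goals ring

theorem mk_inj (h2 : (2 : F) ≠ 0) {e f r s t w x y z u e' f' r' s' t' w' x' y' z' u' : F} :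
    mk e f r s t w x y z u = mk e' f' r' s' t' w' x' y' z' u' ↔
      e = e' ∧ f = f' ∧ r = r' ∧ s = s' ∧ t = t' ∧ w = w' ∧ x = x' ∧ y = y' ∧ z = z' ∧
        u = u' := by
  refine ⟨fun h => ?_, by rintro ⟨rfl, rfl, rfl, rfl, rfl, rfl, rfl, rfl, rfl, rfl⟩; rfl⟩
  have H : ∀ i, _ := fun i => congrFun h i
  have ha := H .a
  have hb := H .b
  have hp1 := H .p1
  have hq1 := H .q1
  have hp2 := H .p2
  have hq2 := H .q2
  simp only [mk] at ha hb hp1 hq1 hp2 hq2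
  refine ⟨H .e, H .f, H .c1, ?_, ?_, H .c2, ?_, ?_, ?_, ?_⟩ <;> apply mul_left_cancel₀ h2
  · linear_combination ha + hb
  · linear_combination ha - hb
  · linear_combination hp1 + hq1
  · linear_combination hp2 - hq2
  · linear_combination hp1 - hq1
  · linear_combination hp2 + hq2

theorem IsGraded.even_mem_odd_mem (h2 : (2 : F) ≠ 0) {B : NonUnitalSubalgebra F (K10 F)}
    (hB : IsGraded B) {e f r s t w x y z u : F} (h : mk e f r s t w x y z u ∈ B) :
    even e f r s t w ∈ B ∧ odd x y z u ∈ B := by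
  obtain ⟨k, hk, l, hl, hk0, hl1, hkl⟩ := hB _ h
  obtain ⟨e', f', r', s', t', w', rfl⟩ := exists_eq_even h2 hk0
  obtain ⟨x', y', z', u', rfl⟩ := exists_eq_odd h2 hl1
  simp only [mk_add_mk, mk_inj h2, add_zero, zero_add] at hkl
  obtain ⟨rfl, rfl, rfl, rfl, rfl, rfl, rfl, rfl, rfl, rfl⟩ := hkl
  exact ⟨hk, hl⟩

theorem isGraded_of_forall_mk (h2 : (2 : F) ≠ 0) {B : NonUnitalSubalgebra F (K10 F)}
    (h : ∀ e f r s t w x y z u : F, mk e f r s t w x y z u ∈ B → even e f r s t w ∈ B) :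
    IsGraded B := by
  intro k hk
  obtain ⟨e, f, r, s, t, w, x, y, z, u, rfl⟩ := exists_eq_mk h2 k
  have h1 := h _ _ _ _ _ _ _ _ _ _ hk
  refine ⟨_, h1, odd x y z u, ?_, even_mem_component _ _ _ _ _ _,
    odd_mem_component _ _ _ _,
    mk_eq_even_add_odd ..⟩
  have := sub_mem hk h1
  simpa [mk_sub_mk] using this

/-- A subalgebra that contains the odd part is the whole algebra. -/
theorem eq_top_of_odd_mem (h2 : (2 : F) ≠ 0) (h3 : (3 : F) ≠ 0)
    {B : NonUnitalSubalgebra F (K10 F)} (hx : odd 1 0 0 0 ∈ B) (hy : odd 0 1 0 0 ∈ B)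
    (hz : odd 0 0 1 0 ∈ B) (hu : odd 0 0 0 1 ∈ B) : B = ⊤ := by
  have h4 : (4 : F) ≠ 0 := by
    have := mul_ne_zero h2 h2; norm_num at this; exact this
  have h8 : (8 : F) ≠ 0 := by
    have := mul_ne_zero h2 h4; norm_num at this; exact this
  have h12 : (12 : F) ≠ 0 := by
    have := mul_ne_zero h3 h4; norm_num at this; exact this
  -- The products of S⁺ with S⁻ give c1, a + b, a - b and c2.
  have hr : even 0 0 1 0 0 0 ∈ B := by
    have := B.smul_mem (-4)⁻¹ (B.mul_mem hx hz)
    rw [odd_mul_odd h2, smul_mk] at this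
    simpa [h4] using this
  have hs : even 0 0 0 1 0 0 ∈ B := by
    have := B.smul_mem 2⁻¹ (B.mul_mem hx hu)
    rw [odd_mul_odd h2, smul_mk] at this
    simpa [h2] using this
  have ht : even 0 0 0 0 1 0 ∈ B := by
    have := B.smul_mem (-2)⁻¹ (B.mul_mem hy hz)
    rw [odd_mul_odd h2, smul_mk] at this
    simpa [h2] using this
  have hw : even 0 0 0 0 0 1 ∈ B := by
    have := B.smul_mem (-4)⁻¹ (B.mul_mem hy hu)
    rw [odd_mul_odd h2, smul_mk] at this
    simpa [h4] using this
  have he : even 1 0 0 0 0 0 ∈ B := by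
    have := B.smul_mem 8⁻¹ (B.mul_mem hs ht)
    simpa [mk_mul_mk h2, smul_mk, h8] using this
  -- The product of the two basis vectors of S⁺ is 4e - 12f; characteristic 3 must be excluded to
  -- recover f.
  have hf : even 0 1 0 0 0 0 ∈ B := by
    have := B.smul_mem (-12)⁻¹ (sub_mem (B.mul_mem hx hy) (B.smul_mem 4 he))
    rw [odd_mul_odd h2, smul_mk, mk_sub_mk, smul_mk] at this
    simpa [h12] using this
  rw [eq_top_iff]
  rintro k -
  obtain ⟨e, f, r, s, t, w, x, y, z, u, rfl⟩ := exists_eq_mk h2 k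
  have := add_mem (add_mem (add_mem (B.smul_mem e he) (B.smul_mem f hf))
    (add_mem (add_mem (B.smul_mem r hr) (B.smul_mem s hs))
      (add_mem (B.smul_mem t ht) (B.smul_mem w hw))))
    (add_mem (add_mem (B.smul_mem x hx) (B.smul_mem y hy))
      (add_mem (B.smul_mem z hz) (B.smul_mem u hu)))
  simpa [smul_mk, mk_add_mk] using this

/-! ### Automorphisms: SL₂ on each half-spin module, and the exchange of the two -/

/-- The matrix with rows `(α, β)` and `(γ, δ)` acting on the first half-spin module, with the
induced action on the even part. -/
def slFun (α β γ δ : F) (k : K10 F) : K10 F :=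
  mk (k .e) (k .f) (α * k .c1 + β * (k .a - k .b)) (α * ((k .a + k .b) / 2) - β / 2 * k .c2)
    (δ * ((k .a - k .b) / 2) + γ / 2 * k .c1) (δ * k .c2 - γ * (k .a + k .b))
    (α * ((k .p1 + k .q1) / 2) + β * ((k .p2 - k .q2) / 2))
    (γ * ((k .p1 + k .q1) / 2) + δ * ((k .p2 - k .q2) / 2))
    ((k .p1 - k .q1) / 2) ((k .p2 + k .q2) / 2)

/-- The factors 2 and 1/2 arise because (r, 2t) and (s, -w/2) transform like (x, y): they are the
S⁺-columns of the tensor in S⁺ ⊗ S⁻. -/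
theorem slFun_mk (h2 : (2 : F) ≠ 0) (α β γ δ e f r s t w x y z u : F) :
    slFun α β γ δ (mk e f r s t w x y z u) =
      mk e f (α * r + 2 * β * t) (α * s - β / 2 * w) (δ * t + γ / 2 * r) (δ * w - 2 * γ * s)
        (α * x + β * y) (γ * x + δ * y) z u := by
  simp only [slFun, mk]
  congr 1 <;> field_simp <;> ring

/-- The endomorphism of the algebra given by a matrix of determinant `1`. -/
def slHom (h2 : (2 : F) ≠ 0) (α β γ δ : F) (h : α * δ - β * γ = 1) : K10 F →ₙₐ[F] K10 F where
  toFun := slFun α β γ δ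
  map_smul' c k := by
    simp only [slFun, smul_apply, smul_mk, MonoidHom.id_apply]
    congr 1 <;> ring
  map_zero' := by
    ext i
    cases i <;> simp [slFun, mk]
  map_add' k l := by
    simp only [slFun, add_apply, mk_add_mk]
    congr 1 <;> ring
  map_mul' k l := by
    obtain ⟨e, f, r, s, t, w, x, y, z, u, rfl⟩ := exists_eq_mk h2 k
    obtain ⟨e', f', r', s', t', w', x', y', z', u', rfl⟩ := exists_eq_mk h2 l
    simp only [mk_mul_mk h2, slFun_mk h2, mk_inj h2]
    refine ⟨?_, ?_, ?_, ?_, ?_, ?_, ?_, ?_, ?_, ?_⟩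
    -- Determinant 1 is needed exactly where S⁺ is contracted with itself: here and in the f, z and
    -- u coordinates.
    · field_simp
      linear_combination -4 *
        (2 * (r * w' + w * r') + 8 * (s * t' + t * s') + 4 * (x * y' - y * x')) * h
    · linear_combination 12 * (x * y' - y * x') * h
    · ring
    · field_simp
      ring
    · field_simp
      ring
    · ring
    · field_simp
      ring
    · field_simp
      ring
    · field_simp
      linear_combination (-4 * (t * x' + t' * x) + 2 * (r * y' + r' * y)) * h
    · field_simp
      linear_combination (-4 * (s * y' + s' * y) - 2 * (w * x' + w' * x)) * h

theorem slHom_mk (h2 : (2 : F) ≠ 0) {α β γ δ : F} (h : α * δ - β * γ = 1)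
    (e f r s t w x y z u : F) :
    slHom h2 α β γ δ h (mk e f r s t w x y z u) =
      mk e f (α * r + 2 * β * t) (α * s - β / 2 * w) (δ * t + γ / 2 * r) (δ * w - 2 * γ * s)
        (α * x + β * y) (γ * x + δ * y) z u :=
  slFun_mk h2 ..

theorem isGradedAutomorphism_of_inverse (h2 : (2 : F) ≠ 0) {φ ψ : K10 F →ₙₐ[F] K10 F}
    (h1 : ∀ k, φ (ψ k) = k) (h1' : ∀ k, ψ (φ k) = k)
    (h0 : ∀ e f r s t w : F, φ (even e f r s t w) ∈ component F 0)
    (ho : ∀ x y z u : F, φ (odd x y z u) ∈ component F 1) : IsGradedAutomorphism φ := by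
  refine ⟨⟨Function.LeftInverse.injective h1', Function.RightInverse.surjective h1⟩, ?_⟩
  intro d k hk
  fin_cases d
  · obtain ⟨e, f, r, s, t, w, rfl⟩ := exists_eq_even h2 hk
    exact h0 _ _ _ _ _ _
  · obtain ⟨x, y, z, u, rfl⟩ := exists_eq_odd h2 hk
    exact ho _ _ _ _

theorem slHom_inverse (h2 : (2 : F) ≠ 0) {α β γ δ : F} (h : α * δ - β * γ = 1)
    (h' : δ * α - (-β) * (-γ) = 1) (k : K10 F) :
    slHom h2 δ (-β) (-γ) α h' (slHom h2 α β γ δ h k) = k := by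
  obtain ⟨e, f, r, s, t, w, x, y, z, u, rfl⟩ := exists_eq_mk h2 k
  simp only [slHom_mk, mk_inj h2, true_and, and_true]
  refine ⟨?_, ?_, ?_, ?_, ?_, ?_⟩
  · field_simp
    linear_combination r * h
  · field_simp
    linear_combination 2 * s * h
  · field_simp
    linear_combination 2 * t * h
  · field_simp
    linear_combination w * h
  · linear_combination x * h
  · linear_combination y * h

theorem isGradedAutomorphism_slHom (h2 : (2 : F) ≠ 0) {α β γ δ : F} (h : α * δ - β * γ = 1) :
    IsGradedAutomorphism (slHom h2 α β γ δ h) := by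
  have h' : δ * α - (-β) * (-γ) = 1 := by linear_combination h
  refine isGradedAutomorphism_of_inverse h2 (ψ := slHom h2 δ (-β) (-γ) α h') (fun k => ?_)
    (slHom_inverse h2 h h') ?_ ?_
  · simpa using slHom_inverse h2 h' (by linear_combination h) k
  · intro e f r s t w
    rw [slHom_mk]
    simpa using even_mem_component _ _ _ _ _ _
  · intro x y z u
    rw [slHom_mk]
    simpa using odd_mem_component _ _ _ _

/-- The exchange of the two half-spin modules. -/
def swapFun (k : K10 F) : K10 F
  | .e => k .e
  | .f => k .f
  | .a => k .a
  | .b => -k .b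
  | .c1 => -k .c1
  | .c2 => -k .c2
  | .p1 => k .p1
  | .p2 => k .p2
  | .q1 => -k .q1
  | .q2 => -k .q2

/-- The signs of r and w are forced by the antisymmetry of x z' - z x' and y u' - u y' under the
exchange. -/
theorem swapFun_mk (e f r s t w x y z u : F) :
    swapFun (mk e f r s t w x y z u) = mk e f (-r) t s (-w) z u x y := by
  ext i
  cases i <;> simp only [swapFun, mk] <;> ring

/-- The endomorphism of the algebra that exchanges the two half-spin modules. -/
def swapHom (h2 : (2 : F) ≠ 0) : K10 F →ₙₐ[F] K10 F where
  toFun := swapFun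
  map_smul' c k := by
    ext i
    cases i <;> simp [swapFun]
  map_zero' := by
    ext i
    cases i <;> simp [swapFun]
  map_add' k l := by
    ext i
    cases i <;> simp only [swapFun, add_apply] <;> ring
  map_mul' k l := by
    obtain ⟨e, f, r, s, t, w, x, y, z, u, rfl⟩ := exists_eq_mk h2 k
    obtain ⟨e', f', r', s', t', w', x', y', z', u', rfl⟩ := exists_eq_mk h2 l
    simp only [mk_mul_mk h2, swapFun_mk]
    congr 1 <;> ring

theorem swapHom_mk (h2 : (2 : F) ≠ 0) (e f r s t w x y z u : F) :
    swapHom h2 (mk e f r s t w x y z u) = mk e f (-r) t s (-w) z u x y :=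
  swapFun_mk ..

theorem isGradedAutomorphism_swapHom (h2 : (2 : F) ≠ 0) :
    IsGradedAutomorphism (swapHom h2) := by
  have H : ∀ k, swapHom h2 (swapHom h2 k) = k := by
    intro k
    obtain ⟨e, f, r, s, t, w, x, y, z, u, rfl⟩ := exists_eq_mk h2 k
    simp [swapHom_mk]
  refine isGradedAutomorphism_of_inverse h2 H H ?_ ?_
  · intro e f r s t w
    rw [swapHom_mk]
    exact even_mem_component _ _ _ _ _ _
  · intro x y z u
    rw [swapHom_mk]
    simpa using odd_mem_component _ _ _ _

theorem IsGradedAutomorphism.comp {φ ψ : K10 F →ₙₐ[F] K10 F} (hφ : IsGradedAutomorphism φ)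
    (hψ : IsGradedAutomorphism ψ) : IsGradedAutomorphism (φ.comp ψ) :=
  ⟨hφ.1.comp hψ.1, fun d k hk => hφ.2 d _ (hψ.2 d k hk)⟩

theorem IsGraded.map {φ : K10 F →ₙₐ[F] K10 F} (hφ : IsGradedAutomorphism φ)
    {B : NonUnitalSubalgebra F (K10 F)} (hB : IsGraded B) : IsGraded (B.map φ) := by
  rintro _ ⟨k, hk, rfl⟩
  obtain ⟨y, hy, z, hz, hy0, hz1, rfl⟩ := hB k hk
  exact ⟨φ y, ⟨y, hy, rfl⟩, φ z, ⟨z, hz, rfl⟩, hφ.2 0 y hy0, hφ.2 1 z hz1, map_add φ y z⟩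

theorem map_ne_top {φ : K10 F →ₙₐ[F] K10 F} (hφ : Function.Injective φ)
    {B : NonUnitalSubalgebra F (K10 F)} (hB : B ≠ ⊤) : B.map φ ≠ ⊤ := by
  intro h
  apply hB
  rw [eq_top_iff]
  rintro k -
  have hk : φ k ∈ B.map φ := h ▸ NonUnitalAlgebra.mem_top
  obtain ⟨l, hl, hlk⟩ := hk
  exact hφ hlk ▸ hl

theorem IsGraded.comap (h2 : (2 : F) ≠ 0) {φ : K10 F →ₙₐ[F] K10 F}
    (hφ : IsGradedAutomorphism φ)
    {C : NonUnitalSubalgebra F (K10 F)} (hC : IsGraded C) : IsGraded (C.comap φ) := by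
  apply isGraded_of_forall_mk h2
  intro e f r s t w x y z u hk
  rw [mk_eq_even_add_odd] at hk
  have h0 := hφ.2 0 _ (even_mem_component e f r s t w)
  have h1 := hφ.2 1 _ (odd_mem_component x y z u)
  obtain ⟨e', f', r', s', t', w', h0'⟩ := exists_eq_even h2 h0
  obtain ⟨x', y', z', u', h1'⟩ := exists_eq_odd h2 h1
  change φ _ ∈ C at hk
  rw [map_add, h0', h1', ← mk_eq_even_add_odd] at hk
  change φ _ ∈ C
  rw [h0']
  exact (hC.even_mem_odd_mem h2 hk).1

theorem comap_ne_top {φ : K10 F →ₙₐ[F] K10 F} (hφ : Function.Surjective φ)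
    {C : NonUnitalSubalgebra F (K10 F)} (hC : C ≠ ⊤) : C.comap φ ≠ ⊤ := by
  intro h
  apply hC
  rw [eq_top_iff]
  rintro k -
  obtain ⟨l, rfl⟩ := hφ k
  have hl : l ∈ C.comap φ := h ▸ NonUnitalAlgebra.mem_top
  exact hl

/-! ### The four standard subalgebras -/

/-- The even part as a subalgebra. -/
def evenSubalgebra : NonUnitalSubalgebra F (K10 F) where
  carrier := {k | k .p1 = 0 ∧ k .p2 = 0 ∧ k .q1 = 0 ∧ k .q2 = 0}
  zero_mem' := by simp
  add_mem' := by
    rintro k l ⟨h1, h2, h3, h4⟩ ⟨h5, h6, h7, h8⟩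
    simp [*]
  smul_mem' := by
    rintro c k ⟨h1, h2, h3, h4⟩
    simp [*]
  mul_mem' := by
    rintro k l ⟨h1, h2, h3, h4⟩ ⟨h5, h6, h7, h8⟩
    simp [mul_def, sum_kacIdx, table, v_apply, *]

/-- The span of `e, f, a, p1, p2` as a subalgebra. -/
def diagonalSubalgebra : NonUnitalSubalgebra F (K10 F) where
  carrier := {k | k .b = 0 ∧ k .c1 = 0 ∧ k .c2 = 0 ∧ k .q1 = 0 ∧ k .q2 = 0}
  zero_mem' := by simp
  add_mem' := by
    rintro k l ⟨h1, h2, h3, h4, h5⟩ ⟨h1', h2', h3', h4', h5'⟩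
    simp [*]
  smul_mem' := by
    rintro c k ⟨h1, h2, h3, h4, h5⟩
    simp [*]
  mul_mem' := by
    rintro k l ⟨h1, h2, h3, h4, h5⟩ ⟨h1', h2', h3', h4', h5'⟩
    simp [mul_def, sum_kacIdx, table, v_apply, *]

/-- The span of `e, f, a + b, c1, p1, q1, p2 + q2` as a subalgebra. -/
def parabolicSubalgebra : NonUnitalSubalgebra F (K10 F) where
  carrier := {k | k .b = k .a ∧ k .c2 = 0 ∧ k .q2 = k .p2}
  zero_mem' := by simp
  add_mem' := by
    rintro k l ⟨h1, h2, h3⟩ ⟨h1', h2', h3'⟩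
    simp [*]
  smul_mem' := by
    rintro c k ⟨h1, h2, h3⟩
    simp [*]
  mul_mem' := by
    rintro k l ⟨h1, h2, h3⟩ ⟨h1', h2', h3'⟩
    simp only [Set.mem_ofPred_eq, mul_def, sum_kacIdx, table, add_apply, smul_apply, smul_zero,
      smul_add, smul_sub, zero_apply, smul_neg, neg_apply, sub_apply, v_apply, h1, h2, h3, h1',
      h2', h3']
    refine ⟨?_, ?_, ?_⟩ <;> simp <;> ring

/-- The span of `e, f, a, b, c1, p1, q1` as a subalgebra. -/
def isotropicSubalgebra : NonUnitalSubalgebra F (K10 F) where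
  carrier := {k | k .c2 = 0 ∧ k .p2 = 0 ∧ k .q2 = 0}
  zero_mem' := by simp
  add_mem' := by
    rintro k l ⟨h1, h2, h3⟩ ⟨h1', h2', h3'⟩
    simp [*]
  smul_mem' := by
    rintro c k ⟨h1, h2, h3⟩
    simp [*]
  mul_mem' := by
    rintro k l ⟨h1, h2, h3⟩ ⟨h1', h2', h3'⟩
    simp [mul_def, sum_kacIdx, table, v_apply, *]

theorem add_self_eq_zero_iff (h2 : (2 : F) ≠ 0) (a : F) : a + a = 0 ↔ a = 0 := by
  rw [← two_mul, mul_eq_zero, or_iff_right h2]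

theorem mk_mem_evenSubalgebra (h2 : (2 : F) ≠ 0) (e f r s t w x y z u : F) :
    mk e f r s t w x y z u ∈ evenSubalgebra ↔ x = 0 ∧ y = 0 ∧ z = 0 ∧ u = 0 := by
  change x + z = 0 ∧ y + u = 0 ∧ x - z = 0 ∧ u - y = 0 ↔ _
  constructor
  · rintro ⟨h, h', hxz, huy⟩
    obtain rfl := sub_eq_zero.1 hxz
    obtain rfl := sub_eq_zero.1 huy
    simp_all [add_self_eq_zero_iff h2]
  · rintro ⟨rfl, rfl, rfl, rfl⟩
    simp

theorem mk_mem_diagonalSubalgebra (e f r s t w x y z u : F) :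
    mk e f r s t w x y z u ∈ diagonalSubalgebra ↔ s = t ∧ r = 0 ∧ w = 0 ∧ x = z ∧ u = y := by
  change s - t = 0 ∧ r = 0 ∧ w = 0 ∧ x - z = 0 ∧ u - y = 0 ↔ _
  simp only [sub_eq_zero]

theorem mk_mem_parabolicSubalgebra (h2 : (2 : F) ≠ 0) (e f r s t w x y z u : F) :
    mk e f r s t w x y z u ∈ parabolicSubalgebra ↔ t = 0 ∧ w = 0 ∧ y = 0 := by
  change s - t = s + t ∧ w = 0 ∧ u - y = y + u ↔ _
  rw [← add_self_eq_zero_iff h2 t, ← add_self_eq_zero_iff h2 y]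
  refine and_congr ?_ (and_congr Iff.rfl ?_)
  · constructor <;> intro h <;> linear_combination -h
  · constructor <;> intro h <;> linear_combination -h

theorem mk_mem_isotropicSubalgebra (h2 : (2 : F) ≠ 0) (e f r s t w x y z u : F) :
    mk e f r s t w x y z u ∈ isotropicSubalgebra ↔ w = 0 ∧ y = 0 ∧ u = 0 := by
  change w = 0 ∧ y + u = 0 ∧ u - y = 0 ↔ _
  refine and_congr Iff.rfl ?_
  constructor
  · rintro ⟨h, h'⟩
    obtain rfl := sub_eq_zero.1 h'
    simp_all [add_self_eq_zero_iff h2]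
  · rintro ⟨rfl, rfl⟩
    simp

theorem isGraded_evenSubalgebra (h2 : (2 : F) ≠ 0) :
    IsGraded (evenSubalgebra : NonUnitalSubalgebra F (K10 F)) := by
  apply isGraded_of_forall_mk h2
  simp +contextual [mk_mem_evenSubalgebra h2]

theorem isGraded_diagonalSubalgebra (h2 : (2 : F) ≠ 0) :
    IsGraded (diagonalSubalgebra : NonUnitalSubalgebra F (K10 F)) := by
  apply isGraded_of_forall_mk h2
  simp +contextual [mk_mem_diagonalSubalgebra]

theorem isGraded_parabolicSubalgebra (h2 : (2 : F) ≠ 0) :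
    IsGraded (parabolicSubalgebra : NonUnitalSubalgebra F (K10 F)) := by
  apply isGraded_of_forall_mk h2
  simp +contextual [mk_mem_parabolicSubalgebra h2]

theorem isGraded_isotropicSubalgebra (h2 : (2 : F) ≠ 0) :
    IsGraded (isotropicSubalgebra : NonUnitalSubalgebra F (K10 F)) := by
  apply isGraded_of_forall_mk h2
  simp +contextual [mk_mem_isotropicSubalgebra h2]

theorem ne_top_of_odd_notMem {B : NonUnitalSubalgebra F (K10 F)} (h : odd 0 1 0 0 ∉ B) :
    B ≠ ⊤ := by
  rintro rfl
  exact h NonUnitalAlgebra.mem_top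

theorem isType1_evenSubalgebra :
    IsType1 (evenSubalgebra : NonUnitalSubalgebra F (K10 F)) := by
  ext k
  constructor
  · rintro ⟨h1, h2, h3, h4⟩ i hi
    cases i <;> first | assumption | exact absurd rfl hi
  · intro h
    exact ⟨h .p1 (by decide), h .p2 (by decide), h .q1 (by decide), h .q2 (by decide)⟩

theorem isType2_diagonalSubalgebra :
    IsType2 (diagonalSubalgebra : NonUnitalSubalgebra F (K10 F)) := by
  refine ⟨?_, le_antisymm ?_ ?_⟩
  · rw [Fintype.linearIndependent_iff]
    intro g hg
    simp only [Fin.sum_univ_succ, Fin.sum_univ_zero, Matrix.cons_val_zero, Matrix.cons_val_succ,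
      add_zero] at hg
    have H : ∀ i, _ := fun i => congrFun hg i
    have h0 := H .e
    have h1 := H .f
    have h2 := H .a
    have h3 := H .p1
    have h4 := H .p2
    simp [v_apply] at h0 h1 h2 h3 h4
    intro i
    fin_cases i <;> assumption
  · rw [Submodule.span_le]
    simp only [Matrix.range_cons, Matrix.range_empty, Set.union_empty, Set.singleton_union,
      Set.insert_subset_iff, Set.singleton_subset_iff]
    refine ⟨?_, ?_, ?_, ?_, ?_⟩ <;>
      exact ⟨by simp [v_apply], by simp [v_apply], by simp [v_apply],
      by simp [v_apply], by simp [v_apply]⟩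
  · rintro k ⟨h1, h2, h3, h4, h5⟩
    rw [Submodule.mem_span_range_iff_exists_fun]
    refine ⟨![k .e, k .f, k .a, k .p1, k .p2], ?_⟩
    simp only [Fin.sum_univ_succ, Fin.sum_univ_zero, Matrix.cons_val_zero, Matrix.cons_val_succ,
      add_zero]
    ext i
    cases i <;> simp [v_apply, *]

theorem isType3_parabolicSubalgebra :
    IsType3 (parabolicSubalgebra : NonUnitalSubalgebra F (K10 F)) := by
  refine ⟨?_, le_antisymm ?_ ?_⟩
  · rw [Fintype.linearIndependent_iff]
    intro g hg
    simp only [Fin.sum_univ_succ, Fin.sum_univ_zero, Matrix.cons_val_zero, Matrix.cons_val_succ,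
      add_zero] at hg
    have H : ∀ i, _ := fun i => congrFun hg i
    have h0 := H .e
    have h1 := H .f
    have h2 := H .a
    have h3 := H .c1
    have h4 := H .p1
    have h5 := H .q1
    have h6 := H .p2
    simp [v_apply] at h0 h1 h2 h3 h4 h5 h6
    intro i
    fin_cases i <;> assumption
  · rw [Submodule.span_le]
    simp only [Matrix.range_cons, Matrix.range_empty, Set.union_empty, Set.singleton_union,
      Set.insert_subset_iff, Set.singleton_subset_iff]
    refine ⟨?_, ?_, ?_, ?_, ?_, ?_, ?_⟩ <;>
      exact ⟨by simp [v_apply], by simp [v_apply], by simp [v_apply]⟩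
  · rintro k ⟨h1, h2, h3⟩
    rw [Submodule.mem_span_range_iff_exists_fun]
    refine ⟨![k .e, k .f, k .a, k .c1, k .p1, k .q1, k .p2], ?_⟩
    simp only [Fin.sum_univ_succ, Fin.sum_univ_zero, Matrix.cons_val_zero, Matrix.cons_val_succ,
      add_zero]
    ext i
    cases i <;> simp [v_apply, *]

theorem isType4_isotropicSubalgebra :
    IsType4 (isotropicSubalgebra : NonUnitalSubalgebra F (K10 F)) := by
  refine ⟨?_, le_antisymm ?_ ?_⟩
  · rw [Fintype.linearIndependent_iff]
    intro g hg
    simp only [Fin.sum_univ_succ, Fin.sum_univ_zero, Matrix.cons_val_zero, Matrix.cons_val_succ,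
      add_zero] at hg
    have H : ∀ i, _ := fun i => congrFun hg i
    have h0 := H .e
    have h1 := H .f
    have h2 := H .a
    have h3 := H .b
    have h4 := H .c1
    have h5 := H .p1
    have h6 := H .q1
    simp [v_apply] at h0 h1 h2 h3 h4 h5 h6
    intro i
    fin_cases i <;> assumption
  · rw [Submodule.span_le]
    simp only [Matrix.range_cons, Matrix.range_empty, Set.union_empty, Set.singleton_union,
      Set.insert_subset_iff, Set.singleton_subset_iff]
    refine ⟨?_, ?_, ?_, ?_, ?_, ?_, ?_⟩ <;>
      exact ⟨by simp [v_apply], by simp [v_apply], by simp [v_apply]⟩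
  · rintro k ⟨h1, h2, h3⟩
    rw [Submodule.mem_span_range_iff_exists_fun]
    refine ⟨![k .e, k .f, k .a, k .b, k .c1, k .p1, k .q1], ?_⟩
    simp only [Fin.sum_univ_succ, Fin.sum_univ_zero, Matrix.cons_val_zero, Matrix.cons_val_succ,
      add_zero]
    ext i
    cases i <;> simp [v_apply, *]

/-! ### Upper bounds for a graded subalgebra in terms of its odd elements -/

theorem le_evenSubalgebra (h2 : (2 : F) ≠ 0) {B : NonUnitalSubalgebra F (K10 F)}
    (hB : IsGraded B)
    (h : ∀ x y z u : F, odd x y z u ∈ B → x = 0 ∧ y = 0 ∧ z = 0 ∧ u = 0) :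
    B ≤ evenSubalgebra := by
  intro k hk
  obtain ⟨e, f, r, s, t, w, x, y, z, u, rfl⟩ := exists_eq_mk h2 k
  rw [mk_mem_evenSubalgebra h2]
  exact h _ _ _ _ (hB.even_mem_odd_mem h2 hk).2

/-- An even element of B must preserve the graph x = z, y = u. Applied to the first vector this
gives s = t and w = -w, applied to the second r = -r. -/
theorem le_diagonalSubalgebra (h2 : (2 : F) ≠ 0) {B : NonUnitalSubalgebra F (K10 F)}
    (hB : IsGraded B) (hx : odd 1 0 1 0 ∈ B) (hy : odd 0 1 0 1 ∈ B)
    (h : ∀ x y z u : F, odd x y z u ∈ B → x = z ∧ u = y) :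
    B ≤ diagonalSubalgebra := by
  intro k hk
  obtain ⟨e, f, r, s, t, w, x, y, z, u, rfl⟩ := exists_eq_mk h2 k
  obtain ⟨h0, h1⟩ := hB.even_mem_odd_mem h2 hk
  have hex := B.mul_mem h0 hx
  have hey := B.mul_mem h0 hy
  rw [even_mul_odd h2] at hex hey
  obtain ⟨hst, hw⟩ := h _ _ _ _ hex
  obtain ⟨hr, -⟩ := h _ _ _ _ hey
  rw [mk_mem_diagonalSubalgebra]
  refine ⟨mul_left_cancel₀ h2 ?_, mul_left_cancel₀ h2 ?_, mul_left_cancel₀ h2 ?_, h _ _ _ _ h1⟩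
  · linear_combination hst
  · linear_combination hr
  · linear_combination hw

/-- An even element sends the basis of S⁻ to vectors with y-coordinates -w and 2t, which must
vanish. -/
theorem le_parabolicSubalgebra (h2 : (2 : F) ≠ 0) {B : NonUnitalSubalgebra F (K10 F)}
    (hB : IsGraded B) (hz : odd 0 0 1 0 ∈ B) (hu : odd 0 0 0 1 ∈ B)
    (h : ∀ x y z u : F, odd x y z u ∈ B → y = 0) :
    B ≤ parabolicSubalgebra := by
  intro k hk
  obtain ⟨e, f, r, s, t, w, x, y, z, u, rfl⟩ := exists_eq_mk h2 k
  obtain ⟨h0, h1⟩ := hB.even_mem_odd_mem h2 hk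
  have hez := B.mul_mem h0 hz
  have heu := B.mul_mem h0 hu
  rw [even_mul_odd h2] at hez heu
  rw [mk_mem_parabolicSubalgebra h2]
  refine ⟨mul_left_cancel₀ h2 ?_, ?_, h _ _ _ _ h1⟩
  · linear_combination h _ _ _ _ heu
  · linear_combination -h _ _ _ _ hez

/-- The case where B₁ is a single line: the S⁻-component of the image of p1 + q1 under an even
element is (2t, w). The containment is strict here, which suffices for the reduction. -/
theorem le_parabolicSubalgebra_of_line (h2 : (2 : F) ≠ 0) {B : NonUnitalSubalgebra F (K10 F)}
    (hB : IsGraded B) (hx : odd 1 0 0 0 ∈ B)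
    (h : ∀ x y z u : F, odd x y z u ∈ B → y = 0 ∧ z = 0 ∧ u = 0) :
    B ≤ parabolicSubalgebra := by
  intro k hk
  obtain ⟨e, f, r, s, t, w, x, y, z, u, rfl⟩ := exists_eq_mk h2 k
  obtain ⟨h0, h1⟩ := hB.even_mem_odd_mem h2 hk
  have hex := B.mul_mem h0 hx
  rw [even_mul_odd h2] at hex
  obtain ⟨-, ht, hw⟩ := h _ _ _ _ hex
  rw [mk_mem_parabolicSubalgebra h2]
  refine ⟨mul_left_cancel₀ h2 ?_, ?_, (h _ _ _ _ h1).1⟩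
  · linear_combination ht
  · linear_combination hw

theorem le_isotropicSubalgebra (h2 : (2 : F) ≠ 0) {B : NonUnitalSubalgebra F (K10 F)}
    (hB : IsGraded B) (hx : odd 1 0 1 0 ∈ B)
    (h : ∀ x y z u : F, odd x y z u ∈ B → y = 0 ∧ u = 0) :
    B ≤ isotropicSubalgebra := by
  intro k hk
  obtain ⟨e, f, r, s, t, w, x, y, z, u, rfl⟩ := exists_eq_mk h2 k
  obtain ⟨h0, h1⟩ := hB.even_mem_odd_mem h2 hk
  have hex := B.mul_mem h0 hx
  rw [even_mul_odd h2] at hex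
  rw [mk_mem_isotropicSubalgebra h2]
  refine ⟨?_, h _ _ _ _ h1⟩
  linear_combination (h _ _ _ _ hex).2

/-! ### Moving a proper graded subalgebra into a standard one -/

/-- `C` is one of the four standard subalgebras. -/
def IsStandard (C : NonUnitalSubalgebra F (K10 F)) : Prop :=
  C = evenSubalgebra ∨ C = diagonalSubalgebra ∨ C = parabolicSubalgebra ∨ C = isotropicSubalgebra

/-- Some graded automorphism maps `B` into a standard subalgebra. -/
def IsSubstandard (B : NonUnitalSubalgebra F (K10 F)) : Prop :=
  ∃ φ : K10 F →ₙₐ[F] K10 F, IsGradedAutomorphism φ ∧ ∃ C, IsStandard C ∧ B.map φ ≤ C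

theorem isSubstandard_of_le {B C : NonUnitalSubalgebra F (K10 F)} (hC : IsStandard C)
    (h : B ≤ C) : IsSubstandard B := by
  refine ⟨NonUnitalAlgHom.id F (K10 F), ⟨Function.bijective_id, fun d k hk => hk⟩, C, hC, ?_⟩
  rintro _ ⟨k, hk, rfl⟩
  exact h hk

theorem isSubstandard_of_map {φ : K10 F →ₙₐ[F] K10 F} (hφ : IsGradedAutomorphism φ)
    {B : NonUnitalSubalgebra F (K10 F)} (h : IsSubstandard (B.map φ)) : IsSubstandard B := by
  obtain ⟨ψ, hψ, C, hC, hle⟩ := h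
  refine ⟨ψ.comp φ, hψ.comp hφ, C, hC, ?_⟩
  rintro _ ⟨k, hk, rfl⟩
  exact hle ⟨φ k, ⟨k, hk, rfl⟩, rfl⟩

/-- A nonzero vector of the plane is mapped to the first basis vector by some matrix of
determinant `1`. -/
theorem exists_sl_mul_eq (x y : F) (h : ¬(x = 0 ∧ y = 0)) :
    ∃ α β γ δ : F, α * δ - β * γ = 1 ∧ α * x + β * y = 1 ∧ γ * x + δ * y = 0 := by
  by_cases hx : x = 0
  · have hy : y ≠ 0 := fun hy => h ⟨hx, hy⟩
    exact ⟨0, y⁻¹, -y, 0, by simp [hy], by simp [hy], by simp [hx]⟩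
  · exact ⟨x⁻¹, 0, -y, x, by simp [hx], by simp [hx], by ring⟩

/-- The conjugate of `slHom` that acts on the second half-spin module. -/
def slHom' (h2 : (2 : F) ≠ 0) (α β γ δ : F) (h : α * δ - β * γ = 1) : K10 F →ₙₐ[F] K10 F :=
  (swapHom h2).comp ((slHom h2 α β γ δ h).comp (swapHom h2))

theorem slHom'_odd (h2 : (2 : F) ≠ 0) {α β γ δ : F} (h : α * δ - β * γ = 1) (x y z u : F) :
    slHom' h2 α β γ δ h (odd x y z u) = odd x y (α * z + β * u) (γ * z + δ * u) := by
  simp only [slHom', NonUnitalAlgHom.comp_apply]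
  rw [swapHom_mk, slHom_mk, swapHom_mk]
  simp

theorem slHom_odd (h2 : (2 : F) ≠ 0) {α β γ δ : F} (h : α * δ - β * γ = 1) (x y z u : F) :
    slHom h2 α β γ δ h (odd x y z u) = odd (α * x + β * y) (γ * x + δ * y) z u := by
  rw [slHom_mk]
  simp

theorem swapHom_odd (h2 : (2 : F) ≠ 0) (x y z u : F) :
    swapHom h2 (odd x y z u) = odd z u x y := by
  rw [swapHom_mk]
  simp

theorem isGradedAutomorphism_slHom' (h2 : (2 : F) ≠ 0) {α β γ δ : F} (h : α * δ - β * γ = 1) :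
    IsGradedAutomorphism (slHom' h2 α β γ δ h) :=
  (isGradedAutomorphism_swapHom h2).comp
    ((isGradedAutomorphism_slHom h2 h).comp (isGradedAutomorphism_swapHom h2))

theorem odd_add_odd (x y z u x' y' z' u' : F) :
    odd x y z u + odd x' y' z' u' = odd (x + x') (y + y') (z + z') (u + u') := by
  simp [mk_add_mk]

theorem smul_odd (c x y z u : F) : c • odd x y z u = odd (c * x) (c * y) (c * z) (c * u) := by
  simp [smul_mk]

theorem odd_mem_congr {B : NonUnitalSubalgebra F (K10 F)} {x y z u x' y' z' u' : F}
    (h : odd x y z u ∈ B) (hx : x = x') (hy : y = y') (hz : z = z') (hu : u = u') :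
    odd x' y' z' u' ∈ B := by
  subst hx hy hz hu
  exact h

theorem odd_add_mem {B : NonUnitalSubalgebra F (K10 F)} {x y z u x' y' z' u' : F} (c c' : F)
    (h : odd x y z u ∈ B) (h' : odd x' y' z' u' ∈ B) :
    odd (c * x + c' * x') (c * y + c' * y') (c * z + c' * z') (c * u + c' * u') ∈ B := by
  have := add_mem (B.smul_mem c h) (B.smul_mem c' h')
  rwa [smul_odd, smul_odd, odd_add_odd] at this

/-- This is a quarter of (h h') h''. With ω the sum of the two symplectic forms, h h' has e- and
f-coordinates 4ω and -12ω; since e and f both act on odd vectors by 1/2, they contribute the scalar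
-4ω. -/
theorem odd_triple_mem (h2 : (2 : F) ≠ 0) {B : NonUnitalSubalgebra F (K10 F)}
    {x y z u x' y' z' u' x'' y'' z'' u'' : F} (h : odd x y z u ∈ B) (h' : odd x' y' z' u' ∈ B)
    (h'' : odd x'' y'' z'' u'' ∈ B) :
    odd (-(x * y' - y * x' + z * u' - u * z') * x'' + (x * u' - u * x') * z''
          - (x * z' - z * x') * u'')
        (-(x * y' - y * x' + z * u' - u * z') * y'' - (y * z' - z * y') * u''
          + (y * u' - u * y') * z'')
        (-(x * y' - y * x' + z * u' - u * z') * z'' - (y * z' - z * y') * x''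
          + (x * z' - z * x') * y'')
        (-(x * y' - y * x' + z * u' - u * z') * u'' + (x * u' - u * x') * y''
          - (y * u' - u * y') * x'') ∈ B := by
  have h4 : (4 : F) ≠ 0 := by
    have := mul_ne_zero h2 h2; norm_num at this; exact this
  have H := B.smul_mem 4⁻¹ (B.mul_mem (B.mul_mem h h') h'')
  rw [odd_mul_odd h2, even_mul_odd h2, smul_odd] at H
  refine odd_mem_congr H ?_ ?_ ?_ ?_ <;> field_simp <;> ring

/-- In a subalgebra that contains `p1 + q1` the projections of the odd elements to the
half-spin modules belong to the subalgebra. -/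
theorem odd_snd_mem (h2 : (2 : F) ≠ 0) {B : NonUnitalSubalgebra F (K10 F)}
    (hx : odd 1 0 0 0 ∈ B) {x y z u : F} (h : odd x y z u ∈ B) : odd 0 0 z u ∈ B := by
  have h1 : odd 0 y z u ∈ B :=
    odd_mem_congr (odd_add_mem 1 (-x) h hx) (by ring) (by ring) (by ring) (by ring)
  by_cases hy : y = 0
  · simpa [hy] using h1
  -- In the triple product of p1 + q1 with two copies of (0, y, z, u), the S⁻-terms cancel and
  -- isolate the S⁺-component.
  have h3 : odd 0 (-y ^ 2) 0 0 ∈ B :=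
    odd_mem_congr (odd_triple_mem h2 hx h1 h1) (by ring) (by ring) (by ring) (by ring)
  exact odd_mem_congr (odd_add_mem 1 y⁻¹ h1 h3) (by ring) (by field_simp; ring) (by ring) (by ring)

theorem odd_fst_mem (h2 : (2 : F) ≠ 0) {B : NonUnitalSubalgebra F (K10 F)}
    (hx : odd 1 0 0 0 ∈ B) {x y z u : F} (h : odd x y z u ∈ B) : odd x y 0 0 ∈ B :=
  odd_mem_congr (odd_add_mem 1 (-1) h (odd_snd_mem h2 hx h)) (by ring) (by ring) (by ring) (by ring)

/-- A subspace of the first half-spin module that contains `p1 + q1` and another element is the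
whole half-spin module. -/
theorem odd_y_mem (h2 : (2 : F) ≠ 0) {B : NonUnitalSubalgebra F (K10 F)}
    (hx : odd 1 0 0 0 ∈ B) {x y z u : F} (h : odd x y z u ∈ B) (hy : y ≠ 0) :
    odd 0 1 0 0 ∈ B :=
  odd_mem_congr (odd_add_mem y⁻¹ (-(y⁻¹ * x)) (odd_fst_mem h2 hx h) hx) (by ring) (by simp [hy])
    (by ring) (by ring)

theorem map_mem {φ : K10 F →ₙₐ[F] K10 F} {B : NonUnitalSubalgebra F (K10 F)} {k l : K10 F}
    (hk : k ∈ B) (h : φ k = l) : l ∈ B.map φ :=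
  ⟨k, hk, h⟩

theorem isSubstandard_of_le_parabolicSubalgebra {B : NonUnitalSubalgebra F (K10 F)}
    (h : B ≤ parabolicSubalgebra) : IsSubstandard B :=
  isSubstandard_of_le (.inr (.inr (.inl rfl))) h

theorem isSubstandard_of_le_isotropicSubalgebra {B : NonUnitalSubalgebra F (K10 F)}
    (h : B ≤ isotropicSubalgebra) : IsSubstandard B :=
  isSubstandard_of_le (.inr (.inr (.inr rfl))) h

/-- With S⁻ inside B, the intersection with S⁺ is zero or a line, as B is proper. A line can be
rotated to p1 + q1 without disturbing S⁻. -/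
theorem isSubstandard_of_snd_mem (h2 : (2 : F) ≠ 0) (h3 : (3 : F) ≠ 0)
    {B : NonUnitalSubalgebra F (K10 F)} (hB : IsGraded B)
    (hT : B ≠ ⊤) (hz : odd 0 0 1 0 ∈ B) (hu : odd 0 0 0 1 ∈ B) : IsSubstandard B := by
  by_cases h : ∀ x y z u : F, odd x y z u ∈ B → y = 0
  · exact isSubstandard_of_le_parabolicSubalgebra (le_parabolicSubalgebra h2 hB hz hu h)
  push Not at h
  obtain ⟨x, y, z, u, hm, hy⟩ := h
  have hm' : odd x y 0 0 ∈ B :=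
    odd_mem_congr (odd_add_mem 1 (-1) hm (odd_add_mem z u hz hu)) (by ring) (by ring) (by ring)
      (by ring)
  obtain ⟨α, β, γ, δ, hdet, h1, h0⟩ := exists_sl_mul_eq x y (fun h => hy h.2)
  have hφ := isGradedAutomorphism_slHom h2 hdet
  apply isSubstandard_of_map hφ
  have hx1 := map_mem hm' (slHom_odd h2 hdet _ _ _ _)
  have hz1 := map_mem hz (slHom_odd h2 hdet _ _ _ _)
  have hu1 := map_mem hu (slHom_odd h2 hdet _ _ _ _)
  rw [h1, h0] at hx1
  simp only [mul_zero, add_zero] at hz1 hu1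
  refine isSubstandard_of_le_parabolicSubalgebra
    (le_parabolicSubalgebra h2 (hB.map hφ) hz1 hu1 fun x y z u h => ?_)
  by_contra hy
  exact map_ne_top hφ.1.1 hT (eq_top_of_odd_mem h2 h3 hx1 (odd_y_mem h2 hx1 h hy) hz1 hu1)

theorem isSubstandard_of_fst_mem (h2 : (2 : F) ≠ 0) (h3 : (3 : F) ≠ 0)
    {B : NonUnitalSubalgebra F (K10 F)} (hB : IsGraded B)
    (hT : B ≠ ⊤) (hx : odd 1 0 0 0 ∈ B) (hy : odd 0 1 0 0 ∈ B) : IsSubstandard B := by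
  have hφ := isGradedAutomorphism_swapHom h2
  exact isSubstandard_of_map hφ (isSubstandard_of_snd_mem h2 h3 (hB.map hφ)
    (map_ne_top hφ.1.1 hT) (map_mem hx (swapHom_odd h2 _ _ _ _))
    (map_mem hy (swapHom_odd h2 _ _ _ _)))

/-- B₁ contains a line of each plane: either it contains a whole plane, or it is the sum of the two
lines and B is isotropic. -/
theorem isSubstandard_of_x_mem_z_mem (h2 : (2 : F) ≠ 0) (h3 : (3 : F) ≠ 0)
    {B : NonUnitalSubalgebra F (K10 F)} (hB : IsGraded B)
    (hT : B ≠ ⊤) (hx : odd 1 0 0 0 ∈ B) (hz : odd 0 0 1 0 ∈ B) : IsSubstandard B := by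
  by_cases hy : ∃ x y z u : F, odd x y z u ∈ B ∧ y ≠ 0
  · obtain ⟨x, y, z, u, hm, hy⟩ := hy
    exact isSubstandard_of_fst_mem h2 h3 hB hT hx (odd_y_mem h2 hx hm hy)
  by_cases hu : ∃ x y z u : F, odd x y z u ∈ B ∧ u ≠ 0
  · obtain ⟨x, y, z, u, hm, hu⟩ := hu
    have hu' := odd_add_mem u⁻¹ (-(u⁻¹ * z)) (odd_snd_mem h2 hx hm) hz
    exact isSubstandard_of_snd_mem h2 h3 hB hT hz
      (odd_mem_congr hu' (by ring) (by ring) (by ring) (by simp [hu]))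
  push Not at hy hu
  have hxz := odd_add_mem 1 1 hx hz
  exact isSubstandard_of_le_isotropicSubalgebra (le_isotropicSubalgebra h2 hB
    (odd_mem_congr hxz (by ring) (by ring) (by ring) (by ring))
    fun x y z u h => ⟨hy _ _ _ _ h, hu _ _ _ _ h⟩)

theorem isSubstandard_of_x_mem (h2 : (2 : F) ≠ 0) (h3 : (3 : F) ≠ 0)
    {B : NonUnitalSubalgebra F (K10 F)} (hB : IsGraded B)
    (hT : B ≠ ⊤) (hx : odd 1 0 0 0 ∈ B) : IsSubstandard B := by
  by_cases hy : ∃ x y z u : F, odd x y z u ∈ B ∧ y ≠ 0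
  · obtain ⟨x, y, z, u, hm, hy⟩ := hy
    exact isSubstandard_of_fst_mem h2 h3 hB hT hx (odd_y_mem h2 hx hm hy)
  push Not at hy
  by_cases hzu : ∀ z u : F, odd 0 0 z u ∈ B → z = 0 ∧ u = 0
  · exact isSubstandard_of_le_parabolicSubalgebra (le_parabolicSubalgebra_of_line h2 hB hx
      fun x y z u h => ⟨hy _ _ _ _ h, hzu _ _ (odd_snd_mem h2 hx h)⟩)
  push Not at hzu
  obtain ⟨z, u, hm, hzu⟩ := hzu
  obtain ⟨α, β, γ, δ, hdet, h1, h0⟩ := exists_sl_mul_eq z u (fun h => hzu h.1 h.2)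
  have hφ := isGradedAutomorphism_slHom' h2 hdet
  have hz1 := map_mem hm (slHom'_odd h2 hdet _ _ _ _)
  have hx1 := map_mem hx (slHom'_odd h2 hdet _ _ _ _)
  rw [h1, h0] at hz1
  simp only [mul_zero, add_zero] at hx1
  exact isSubstandard_of_map hφ
    (isSubstandard_of_x_mem_z_mem h2 h3 (hB.map hφ) (map_ne_top hφ.1.1 hT) hx1 hz1)

theorem isSubstandard_of_fst_ne_zero (h2 : (2 : F) ≠ 0) (h3 : (3 : F) ≠ 0)
    {B : NonUnitalSubalgebra F (K10 F)} (hB : IsGraded B)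
    (hT : B ≠ ⊤) {x y : F} (hm : odd x y 0 0 ∈ B) (hxy : ¬(x = 0 ∧ y = 0)) :
    IsSubstandard B := by
  obtain ⟨α, β, γ, δ, hdet, h1, h0⟩ := exists_sl_mul_eq x y hxy
  have hφ := isGradedAutomorphism_slHom h2 hdet
  have hx1 := map_mem hm (slHom_odd h2 hdet _ _ _ _)
  rw [h1, h0] at hx1
  exact isSubstandard_of_map hφ
    (isSubstandard_of_x_mem h2 h3 (hB.map hφ) (map_ne_top hφ.1.1 hT) hx1)

theorem isSubstandard_of_snd_ne_zero (h2 : (2 : F) ≠ 0) (h3 : (3 : F) ≠ 0)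
    {B : NonUnitalSubalgebra F (K10 F)} (hB : IsGraded B)
    (hT : B ≠ ⊤) {z u : F} (hm : odd 0 0 z u ∈ B) (hzu : ¬(z = 0 ∧ u = 0)) :
    IsSubstandard B := by
  have hφ := isGradedAutomorphism_swapHom h2
  exact isSubstandard_of_map hφ (isSubstandard_of_fst_ne_zero h2 h3 (hB.map hφ)
    (map_ne_top hφ.1.1 hT) (map_mem hm (swapHom_odd h2 _ _ _ _)) hzu)

/-- B₁ contains the graph of diag(1, β). If it misses S⁻, the triple product forces the determinant
β to be 1. -/
theorem isSubstandard_of_diagonal_mem (h2 : (2 : F) ≠ 0) (h3 : (3 : F) ≠ 0)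
    {B : NonUnitalSubalgebra F (K10 F)} (hB : IsGraded B)
    (hT : B ≠ ⊤) (hx : odd 1 0 1 0 ∈ B) {β : F} (hβ : β ≠ 0) (hy : odd 0 1 0 β ∈ B) :
    IsSubstandard B := by
  by_cases hzu : ∃ z u : F, odd 0 0 z u ∈ B ∧ ¬(z = 0 ∧ u = 0)
  · obtain ⟨z, u, hm, hzu⟩ := hzu
    exact isSubstandard_of_snd_ne_zero h2 h3 hB hT hm hzu
  push Not at hzu
  -- Adding (1, 0, 1, 0) leaves (0, 0, 1 - β, 0), an element of S⁻.
  have hxy : odd (-1) 0 (-β) 0 ∈ B :=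
    odd_mem_congr (odd_triple_mem h2 hx hy hx) (by ring) (by ring) (by ring) (by ring)
  obtain rfl : β = 1 := by
    have := (hzu _ _ (odd_mem_congr (odd_add_mem 1 1 hxy hx) (by ring) (by ring) rfl rfl)).1
    linear_combination -this
  refine isSubstandard_of_le (.inr (.inl rfl)) (le_diagonalSubalgebra h2 hB hx hy ?_)
  intro x y z u h
  have := hzu (z - x) (u - y) (odd_mem_congr (odd_add_mem 1 (-1) h (odd_add_mem x y hx hy))
    (by ring) (by ring) (by ring) (by ring))
  exact ⟨(sub_eq_zero.1 this.1).symm, sub_eq_zero.1 this.2⟩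

theorem isSubstandard_of_x_add_z_mem (h2 : (2 : F) ≠ 0) (h3 : (3 : F) ≠ 0)
    {B : NonUnitalSubalgebra F (K10 F)} (hB : IsGraded B)
    (hT : B ≠ ⊤) (hx : odd 1 0 1 0 ∈ B) : IsSubstandard B := by
  by_cases hxy : ∃ x y : F, odd x y 0 0 ∈ B ∧ ¬(x = 0 ∧ y = 0)
  · obtain ⟨x, y, hm, hxy⟩ := hxy
    exact isSubstandard_of_fst_ne_zero h2 h3 hB hT hm hxy
  by_cases hzu : ∃ z u : F, odd 0 0 z u ∈ B ∧ ¬(z = 0 ∧ u = 0)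
  · obtain ⟨z, u, hm, hzu⟩ := hzu
    exact isSubstandard_of_snd_ne_zero h2 h3 hB hT hm hzu
  push Not at hxy hzu
  by_cases hy : ∃ x y z u : F, odd x y z u ∈ B ∧ y ≠ 0
  · obtain ⟨x, y, z, u, hm, hy⟩ := hy
    have hm1 : odd 0 1 (y⁻¹ * (z - x)) (y⁻¹ * u) ∈ B :=
      odd_mem_congr (odd_add_mem y⁻¹ (-(y⁻¹ * x)) hm hx) (by ring) (by simp [hy]) (by ring)
        (by ring)
    generalize y⁻¹ * (z - x) = α at hm1
    generalize y⁻¹ * u = β at hm1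
    -- If β = 0, subtracting α(1, 0, 1, 0) gives (-α, 1, 0, 0), a nonzero element of S⁺.
    by_cases hβ : β = 0
    · have := (hxy _ _ (odd_mem_congr (odd_add_mem 1 (-α) hm1 hx) rfl rfl (by ring)
        (by simp [hβ]))).2
      simp at this
    -- This shear of S⁻ fixes (1, 0) and sends (α, β) to (0, β), making the graph diagonal.
    have hdet : (1 : F) * 1 - (-(α / β)) * 0 = 1 := by ring
    have hφ := isGradedAutomorphism_slHom' h2 hdet
    have hx1 := map_mem hx (slHom'_odd h2 hdet _ _ _ _)
    have hy1 := map_mem hm1 (slHom'_odd h2 hdet _ _ _ _)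
    exact isSubstandard_of_map hφ (isSubstandard_of_diagonal_mem h2 h3 (hB.map hφ)
      (map_ne_top hφ.1.1 hT) (odd_mem_congr hx1 rfl rfl (by ring) (by ring)) hβ
      (odd_mem_congr hy1 rfl rfl (by field_simp; ring) (by ring)))
  push Not at hy
  refine isSubstandard_of_le_isotropicSubalgebra (le_isotropicSubalgebra h2 hB hx ?_)
  intro x y z u h
  obtain rfl := hy _ _ _ _ h
  exact ⟨rfl, (hzu (z - x) u (odd_mem_congr (odd_add_mem 1 (-x) h hx) (by ring) (by ring)
    (by ring) (by ring))).2⟩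

/-- A proper graded subalgebra is mapped into a standard one by some graded automorphism. -/
theorem isSubstandard_of_ne_top (h2 : (2 : F) ≠ 0) (h3 : (3 : F) ≠ 0)
    {B : NonUnitalSubalgebra F (K10 F)} (hB : IsGraded B)
    (hT : B ≠ ⊤) : IsSubstandard B := by
  by_cases h : ∀ x y z u : F, odd x y z u ∈ B → x = 0 ∧ y = 0 ∧ z = 0 ∧ u = 0
  · exact isSubstandard_of_le (.inl rfl) (le_evenSubalgebra h2 hB h)
  push Not at h
  obtain ⟨x, y, z, u, hm, h⟩ := h
  by_cases hxy : x = 0 ∧ y = 0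
  · obtain ⟨rfl, rfl⟩ := hxy
    exact isSubstandard_of_snd_ne_zero h2 h3 hB hT hm fun hzu => h rfl rfl hzu.1 hzu.2
  by_cases hzu : z = 0 ∧ u = 0
  · obtain ⟨rfl, rfl⟩ := hzu
    exact isSubstandard_of_fst_ne_zero h2 h3 hB hT hm hxy
  obtain ⟨α, β, γ, δ, hdet, h1, h0⟩ := exists_sl_mul_eq x y hxy
  obtain ⟨α', β', γ', δ', hdet', h1', h0'⟩ := exists_sl_mul_eq z u hzu
  have hφ := isGradedAutomorphism_slHom h2 hdet
  have hφ' := isGradedAutomorphism_slHom' h2 hdet'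
  have hm' := map_mem (map_mem hm (slHom_odd h2 hdet _ _ _ _)) (slHom'_odd h2 hdet' _ _ _ _)
  rw [h1, h0, h1', h0'] at hm'
  exact isSubstandard_of_map hφ (isSubstandard_of_map hφ' (isSubstandard_of_x_add_z_mem h2 h3
    ((hB.map hφ).map hφ') (map_ne_top hφ'.1.1 (map_ne_top hφ.1.1 hT)) hm'))

/-! ### Maximality -/

theorem evenSubalgebra_ne_top : (evenSubalgebra : NonUnitalSubalgebra F (K10 F)) ≠ ⊤ :=
  ne_top_of_odd_notMem fun h => by
    have := h.2.1
    simp [mk] at this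

theorem diagonalSubalgebra_ne_top : (diagonalSubalgebra : NonUnitalSubalgebra F (K10 F)) ≠ ⊤ :=
  ne_top_of_odd_notMem fun h => by
    have := h.2.2.2.2
    simp [mk] at this

theorem parabolicSubalgebra_ne_top (h2 : (2 : F) ≠ 0) :
    (parabolicSubalgebra : NonUnitalSubalgebra F (K10 F)) ≠ ⊤ :=
  ne_top_of_odd_notMem (by simp [mk_mem_parabolicSubalgebra h2])

theorem isotropicSubalgebra_ne_top :
    (isotropicSubalgebra : NonUnitalSubalgebra F (K10 F)) ≠ ⊤ :=
  ne_top_of_odd_notMem fun h => by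
    have := h.2.1
    simp [mk] at this

theorem IsStandard.isGraded (h2 : (2 : F) ≠ 0)
    {C : NonUnitalSubalgebra F (K10 F)} (h : IsStandard C) :
    IsGraded C := by
  rcases h with rfl | rfl | rfl | rfl
  · exact isGraded_evenSubalgebra h2
  · exact isGraded_diagonalSubalgebra h2
  · exact isGraded_parabolicSubalgebra h2
  · exact isGraded_isotropicSubalgebra h2

theorem IsStandard.ne_top (h2 : (2 : F) ≠ 0)
    {C : NonUnitalSubalgebra F (K10 F)} (h : IsStandard C) : C ≠ ⊤ := by
  rcases h with rfl | rfl | rfl | rfl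
  · exact evenSubalgebra_ne_top
  · exact diagonalSubalgebra_ne_top
  · exact parabolicSubalgebra_ne_top h2
  · exact isotropicSubalgebra_ne_top

/-- The preimage of the standard subalgebra is proper, graded and contains B, so it equals B by
maximality. -/
theorem IsMaximalSubalgebra.exists_map_isStandard (h2 : (2 : F) ≠ 0) (h3 : (3 : F) ≠ 0)
    {B : NonUnitalSubalgebra F (K10 F)}
    (hB : IsMaximalSubalgebra B) :
    ∃ φ : K10 F →ₙₐ[F] K10 F, IsGradedAutomorphism φ ∧ IsStandard (B.map φ) := by
  obtain ⟨φ, hφ, C, hC, hle⟩ := isSubstandard_of_ne_top h2 h3 hB.prop.1 hB.prop.2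
  refine ⟨φ, hφ, ?_⟩
  have hCB : C.comap φ ≤ B := hB.le_of_ge
    ⟨(hC.isGraded h2).comap h2 hφ, comap_ne_top hφ.1.2 (hC.ne_top h2)⟩
    fun k hk => hle ⟨k, hk, rfl⟩
  have : B.map φ = C := by
    refine le_antisymm hle fun k hk => ?_
    obtain ⟨l, rfl⟩ := hφ.1.2 k
    exact ⟨l, hCB hk, rfl⟩
  exact this ▸ hC

/-- The odd part is irreducible under the even part: one nonzero odd element yields all of them. -/
theorem isMaximalSubalgebra_evenSubalgebra (h2 : (2 : F) ≠ 0) (h3 : (3 : F) ≠ 0) :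
    IsMaximalSubalgebra (evenSubalgebra : NonUnitalSubalgebra F (K10 F)) := by
  refine ⟨⟨isGraded_evenSubalgebra h2, evenSubalgebra_ne_top⟩, ?_⟩
  rintro D ⟨hD, hT⟩ hle
  have hmem : ∀ e f r s t w : F, even e f r s t w ∈ D := fun e f r s t w =>
    hle (by simp [mk_mem_evenSubalgebra h2])
  have hmul : ∀ (r s t w : F) {x y z u : F}, odd x y z u ∈ D →
      odd (2 * s * z + r * u) (2 * t * u - w * z) (2 * t * x - r * y) (2 * s * y + w * x) ∈ D := by
    intro r s t w x y z u h
    have := D.mul_mem (hmem 0 0 r s t w) h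
    rw [even_mul_odd h2] at this
    simpa using this
  have hz : odd 0 0 1 0 ∉ D := by
    intro hz
    have hx : odd 1 0 0 0 ∈ D :=
      odd_mem_congr (hmul 0 2⁻¹ 0 0 hz) (by simp [h2]) (by ring) (by ring) (by ring)
    have hu : odd 0 0 0 1 ∈ D :=
      odd_mem_congr (hmul 0 0 0 1 hx) (by ring) (by ring) (by ring) (by ring)
    have hy : odd 0 1 0 0 ∈ D :=
      odd_mem_congr (hmul 0 0 2⁻¹ 0 hu) (by ring) (by simp [h2]) (by ring) (by ring)
    exact hT (eq_top_of_odd_mem h2 h3 hx hy hz hu)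
  have hy0 : ∀ x y z u : F, odd x y z u ∈ D → y = 0 := by
    intro x y z u h
    by_contra hy
    -- (x, y, z, u) goes to (2z, 0, 0, 2y), then (0, 2y, 2z, 0), then (0, 0, 1, 0).
    refine hz (odd_mem_congr (hmul (-(2 * y)⁻¹) 0 0 0 (hmul 0 0 2⁻¹ 0 (hmul 0 1 0 0 h))) ?_ ?_ ?_ ?_)
      <;> field_simp <;> ring
  have hz0 : ∀ x y z u : F, odd x y z u ∈ D → z = 0 := fun x y z u h => by
    have := hy0 _ _ _ _ (hmul 0 0 0 1 h)
    linear_combination -this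
  have hu0 : ∀ x y z u : F, odd x y z u ∈ D → u = 0 := fun x y z u h => by
    have := hy0 _ _ _ _ (hmul 0 0 2⁻¹ 0 h)
    simpa [h2] using this
  have hx0 : ∀ x y z u : F, odd x y z u ∈ D → x = 0 := fun x y z u h => by
    have := hu0 _ _ _ _ (hmul 0 0 0 1 h)
    linear_combination this
  exact le_evenSubalgebra h2 hD fun x y z u h =>
    ⟨hx0 _ _ _ _ h, hy0 _ _ _ _ h, hz0 _ _ _ _ h, hu0 _ _ _ _ h⟩

theorem isMaximalSubalgebra_diagonalSubalgebra (h2 : (2 : F) ≠ 0) (h3 : (3 : F) ≠ 0) :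
    IsMaximalSubalgebra (diagonalSubalgebra : NonUnitalSubalgebra F (K10 F)) := by
  refine ⟨⟨isGraded_diagonalSubalgebra h2, diagonalSubalgebra_ne_top⟩, ?_⟩
  rintro D ⟨hD, hT⟩ hle
  have hx : odd 1 0 1 0 ∈ D := hle (by simp [mk_mem_diagonalSubalgebra])
  have hy : odd 0 1 0 1 ∈ D := hle (by simp [mk_mem_diagonalSubalgebra])
  have hz : odd 0 0 1 0 ∉ D := by
    intro hz
    have hx1 : odd 1 0 0 0 ∈ D :=
      odd_mem_congr (odd_add_mem 1 (-1) hx hz) (by ring) (by ring) (by ring) (by ring)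
    have hy1 : odd 0 1 0 0 ∈ D := odd_y_mem h2 hx1 hy one_ne_zero
    exact hT (eq_top_of_odd_mem h2 h3 hx1 hy1 hz
      (odd_mem_congr (odd_add_mem 1 (-1) hy hy1) (by ring) (by ring) (by ring) (by ring)))
  have hzu : ∀ z u : F, odd 0 0 z u ∈ D → z = 0 ∧ u = 0 := by
    intro z u h
    have hu : u = 0 := by
      by_contra hu
      -- This triple product is (0, 0, -u, 0).
      have hz' := odd_triple_mem h2 hx h hx
      exact hz (odd_mem_congr (odd_add_mem (-u⁻¹) 0 hz' hz') (by ring) (by ring)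
        (by field_simp; ring) (by ring))
    subst hu
    refine ⟨?_, rfl⟩
    by_contra hz0
    exact hz (odd_mem_congr (odd_add_mem z⁻¹ 0 h h) (by ring) (by ring) (by simp [hz0]) (by ring))
  refine le_diagonalSubalgebra h2 hD hx hy ?_
  intro x y z u h
  have := hzu (z - x) (u - y) (odd_mem_congr (odd_add_mem 1 (-1) h (odd_add_mem x y hx hy))
    (by ring) (by ring) (by ring) (by ring))
  exact ⟨(sub_eq_zero.1 this.1).symm, sub_eq_zero.1 this.2⟩

theorem isMaximalSubalgebra_parabolicSubalgebra (h2 : (2 : F) ≠ 0) (h3 : (3 : F) ≠ 0) :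
    IsMaximalSubalgebra (parabolicSubalgebra : NonUnitalSubalgebra F (K10 F)) := by
  refine ⟨⟨isGraded_parabolicSubalgebra h2, parabolicSubalgebra_ne_top h2⟩, ?_⟩
  rintro D ⟨hD, hT⟩ hle
  have hx : odd 1 0 0 0 ∈ D := hle (by simp [mk_mem_parabolicSubalgebra h2])
  have hz : odd 0 0 1 0 ∈ D := hle (by simp [mk_mem_parabolicSubalgebra h2])
  have hu : odd 0 0 0 1 ∈ D := hle (by simp [mk_mem_parabolicSubalgebra h2])
  refine le_parabolicSubalgebra h2 hD hz hu fun x y z u h => ?_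
  by_contra hy
  exact hT (eq_top_of_odd_mem h2 h3 hx (odd_y_mem h2 hx h hy) hz hu)

theorem isMaximalSubalgebra_isotropicSubalgebra (h2 : (2 : F) ≠ 0) (h3 : (3 : F) ≠ 0) :
    IsMaximalSubalgebra (isotropicSubalgebra : NonUnitalSubalgebra F (K10 F)) := by
  refine ⟨⟨isGraded_isotropicSubalgebra h2, isotropicSubalgebra_ne_top⟩, ?_⟩
  rintro D ⟨hD, hT⟩ hle
  have hx : odd 1 0 0 0 ∈ D := hle (by simp [mk_mem_isotropicSubalgebra h2])
  have hz : odd 0 0 1 0 ∈ D := hle (by simp [mk_mem_isotropicSubalgebra h2])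
  have hs : even 0 0 0 1 0 0 ∈ D := hle (by simp [mk_mem_isotropicSubalgebra h2])
  have ht : even 0 0 0 0 1 0 ∈ D := hle (by simp [mk_mem_isotropicSubalgebra h2])
  have hy1 : odd 0 1 0 0 ∉ D := by
    intro hy
    have hu := D.mul_mem hs hy
    rw [even_mul_odd h2] at hu
    exact hT (eq_top_of_odd_mem h2 h3 hx hy hz (odd_mem_congr (odd_add_mem 2⁻¹ 0 hu hu)
      (by ring) (by ring) (by ring) (by simp [h2])))
  have hy0 : ∀ x y z u : F, odd x y z u ∈ D → y = 0 := fun x y z u h => by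
    by_contra hy
    exact hy1 (odd_y_mem h2 hx h hy)
  refine le_isotropicSubalgebra h2 hD
    (odd_mem_congr (odd_add_mem 1 1 hx hz) (by ring) (by ring) (by ring) (by ring)) ?_
  intro x y z u h
  refine ⟨hy0 _ _ _ _ h, ?_⟩
  -- Multiplication by a - b has y-coordinate 2u, so the vanishing of y passes to u.
  have hm := D.mul_mem ht h
  rw [even_mul_odd h2] at hm
  simpa [h2] using hy0 _ _ _ _ hm

end

end K10

theorem theorem4p1 {F : Type*} [Field F] [IsAlgClosed F] (h2 : (2 : F) ≠ 0) (h3 : (3 : F) ≠ 0) :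
    (∀ B : NonUnitalSubalgebra F (K10 F), K10.IsMaximalSubalgebra B →
      ∃ φ : K10 F →ₙₐ[F] K10 F, K10.IsGradedAutomorphism φ ∧
        (K10.IsType1 (B.map φ) ∨ K10.IsType2 (B.map φ) ∨
          K10.IsType3 (B.map φ) ∨ K10.IsType4 (B.map φ))) ∧
    (∃ B : NonUnitalSubalgebra F (K10 F), K10.IsType1 B ∧ K10.IsMaximalSubalgebra B) ∧
    (∃ B : NonUnitalSubalgebra F (K10 F), K10.IsType2 B ∧ K10.IsMaximalSubalgebra B) ∧
    (∃ B : NonUnitalSubalgebra F (K10 F), K10.IsType3 B ∧ K10.IsMaximalSubalgebra B) ∧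
    (∃ B : NonUnitalSubalgebra F (K10 F), K10.IsType4 B ∧ K10.IsMaximalSubalgebra B) := by
  open K10 in
  refine ⟨fun B hB => ?_,
    ⟨_, isType1_evenSubalgebra, isMaximalSubalgebra_evenSubalgebra h2 h3⟩,
    ⟨_, isType2_diagonalSubalgebra, isMaximalSubalgebra_diagonalSubalgebra h2 h3⟩,
    ⟨_, isType3_parabolicSubalgebra, isMaximalSubalgebra_parabolicSubalgebra h2 h3⟩,
    ⟨_, isType4_isotropicSubalgebra, isMaximalSubalgebra_isotropicSubalgebra h2 h3⟩⟩
  obtain ⟨φ, hφ, h⟩ := hB.exists_map_isStandard h2 h3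
  refine ⟨φ, hφ, ?_⟩
  rcases h with h | h | h | h <;> rw [h]
  · exact .inl K10.isType1_evenSubalgebra
  · exact .inr (.inl K10.isType2_diagonalSubalgebra)
  · exact .inr (.inr (.inl K10.isType3_parabolicSubalgebra))
  · exact .inr (.inr (.inr K10.isType4_isotropicSubalgebra))
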